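/- Let $T:[0,\pi)\to(-\infty,1]$ be defined by $T(y)=y\cot y$ for $y\in(0,\pi)$ and $T(0)=1$. Then $T$ is a bijection. Let $\delta>0$, $k>0$, $r>0$ and $B\in\mathbb{R}$, and consider the equation $$\lambda+\delta+B=kBe^{-\lambda r},\qquad \lambda\in\mathbb{C}. \tag{1}$$ Whenever $-(\delta+B)r\le 1$, put $\omega_0=\frac1r\,T^{-1}\bigl(-(\delta+B)r\bigr)$. **I.A.** If $B<0$ and $\delta+B<0$, then all solutions of (1) satisfy $\operatorname{Re}\lambda<0$ if and only if $$|\delta+B|<|kB|\quad\text{and}\quad \frac{\arccos\bigl((\delta+B)/(kB)\bigr)}{\omega_0}<r<\frac{1}{|\delta+B|}.$$ (The condition $r<1/|\delta+B|$ ensures that $\omega_0$ is defined and positive; the right-hand side is understood to be false when $r\ge 1/|\delta+B|$.) **I.B.** If $B<0$ and $\delta+B>0$, then all solutions of (1) satisfy $\operatorname{Re}\lambda<0$ if and only if $$\delta+B>|kB|\quad\text{or}\quad\Bigl\{\delta+B\le|kB|\ \text{ and }\ r<\frac{\arccos\bigl((\delta+B)/(kB)\bigr)}{\omega_0}\Bigr\}.$$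 **II.** If $B>0$, then $\delta+B>0$, and all solutions of (1) satisfy $\operatorname{Re}\lambda<0$ if and only if $kB<\delta+B$. -/

import Mathlib

open Set

noncomputable section

/-- `lam` is a solution of the characteristic equation
`lam + δ + B = k B exp (- lam r)`. -/
def IsCharRoot (δ B k r : ℝ) (lam : ℂ) : Prop :=
  lam + (δ : ℂ) + (B : ℂ) = (k : ℂ) * (B : ℂ) * Complex.exp (-lam * (r : ℂ))

/-- All solutions of the characteristic equation have strictly negative real part. -/
def AllRootsNeg (δ B k r : ℝ) : Prop :=
  ∀ lam : ℂ, IsCharRoot δ B k r lam → lam.re < 0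

/-- The function `T(y) = y cot y`, `T(0) = 1`; it is only used on `[0, π)`. -/
def cotT (y : ℝ) : ℝ := if y = 0 then 1 else y * Real.cot y

/-- The inverse of `T : [0, π) → (-∞, 1]`; only its values on `(-∞, 1]` are meaningful. -/
def cotTInv (s : ℝ) : ℝ := Function.invFunOn cotT (Ico 0 Real.pi) s

/-- `ω₀ = T⁻¹(-(δ + B) r) / r`. -/
def omegaZero (δ B r : ℝ) : ℝ := 1 / r * cotTInv (-(δ + B) * r)

end

/-!
Everything is read off from the identity `T(y) = cos y / sinc y`. It makes `T` continuous on
`[0, π)`; its derivative there is a positive multiple of `sin y cos y - y`, so `T` is strictly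
decreasing, and it tends to `-∞` at `π`.

Substituting `z = λ r` turns the characteristic equation into `z + a = c e^{-z}`, with
`a = (δ + B) r` and `c = k B r`. If `c ≥ 0` and `a > 0`, comparing moduli shows that there is no
root with `Re z ≥ 0` when `c < a`, and the intermediate value theorem gives a nonnegative real root
when `a ≤ c`.

Let `c = -b < 0`, and let `ζ = T⁻¹(-a)`, defined when `a ≥ -1`. In the strip `0 ≤ Im z < π`, each
`y` with `e^{-T(y)} = b e^a sinc y` gives the root `-a - T(y) + i y`. As `e^{-T} / sinc` is
continuous on `[0, π)` and unbounded near `π`, the intermediate value theorem on `[ζ, π)` yields a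
root with nonnegative real part as soon as `1 ≤ b sinc ζ`
(`exists_root_of_one_le_mul_sinc`); for `a ≤ -1` or `a + b ≤ 0` such a root always exists
(`exists_root_of_le_neg_one`, `exists_real_root`). Conversely, if `a > -1`, `a + b > 0` and
`b sinc ζ < 1`, a root `x + i y` with `x, y ≥ 0` and `0 < y < π` has `T(y) = -a - x ≤ T(ζ)`, so
`y ≥ ζ`; but `b e^{-x} sinc y = 1`, which is impossible as `sinc` is decreasing. If `y ≥ π` and
`a ≥ 0`, then `|z + a| ≤ b` contradicts `ζ² + a² = (sinc ζ)⁻² > b²`; if `y ≥ π` and `a < 0`, then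
`ζ < π / 2`, hence `b < π / 2`, contradicting `y ≤ b` (`re_neg_of_root`). Finally
`cos ζ = -a sinc ζ` turns `b sinc ζ < 1` into a comparison of `ζ` with `arccos (-a / b)`.
-/

/-! ### The function `y cot y` -/

theorem cotT_eq_cos_div_sinc (y : ℝ) : cotT y = Real.cos y / Real.sinc y := by
  unfold cotT
  split_ifs with h
  · simp [h]
  · rw [Real.sinc_of_ne_zero h, Real.cot_eq_cos_div_sin, div_div_eq_mul_div]
    ring

theorem cotT_zero : cotT 0 = 1 := by simp [cotT]

theorem sinc_pos_of_mem_Ico {y : ℝ} (hy : y ∈ Ico 0 Real.pi) : 0 < Real.sinc y := by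
  rcases hy.1.eq_or_lt with h | h
  · simp [← h]
  · rw [Real.sinc_of_ne_zero h.ne']
    exact div_pos (Real.sin_pos_of_pos_of_lt_pi h hy.2) h

theorem mul_sinc (y : ℝ) : y * Real.sinc y = Real.sin y := by
  rcases eq_or_ne y 0 with h | h
  · simp [h]
  · rw [Real.sinc_of_ne_zero h]
    field_simp

/-- `sinc` is the slope of the chords of `sin` through the origin, and `sin` is concave. -/
theorem antitoneOn_sinc : AntitoneOn Real.sinc (Icc 0 Real.pi) := by
  intro x hx y hy hxy
  rcases hx.1.eq_or_lt with h | h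
  · simpa [← h] using Real.sinc_le_one y
  have hy0 : 0 < y := h.trans_le hxy
  have hc := strictConcaveOn_sin_Icc.concaveOn.2 hy ⟨le_rfl, Real.pi_pos.le⟩
    (div_nonneg h.le hy0.le) (sub_nonneg.2 ((div_le_one hy0).2 hxy)) (add_sub_cancel _ _)
  simp only [smul_eq_mul, Real.sin_zero, mul_zero, add_zero, div_mul_cancel₀ _ hy0.ne'] at hc
  rw [Real.sinc_of_ne_zero h.ne', Real.sinc_of_ne_zero hy0.ne', le_div_iff₀ h]
  linarith [hc, div_mul_comm x y (Real.sin y), mul_comm (Real.sin y / y) x]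

theorem cotT_mul_sinc {y : ℝ} (hy : y ∈ Ico 0 Real.pi) :
    cotT y * Real.sinc y = Real.cos y := by
  rw [cotT_eq_cos_div_sinc, div_mul_cancel₀ _ (sinc_pos_of_mem_Ico hy).ne']

theorem continuousOn_cotT : ContinuousOn cotT (Ico 0 Real.pi) := by
  rw [show cotT = fun y => Real.cos y / Real.sinc y from funext cotT_eq_cos_div_sinc]
  exact Real.continuous_cos.continuousOn.div Real.continuous_sinc.continuousOn
    fun y hy => (sinc_pos_of_mem_Ico hy).ne'

theorem strictAntiOn_cotT : StrictAntiOn cotT (Ico 0 Real.pi) := by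
  refine strictAntiOn_of_deriv_neg (convex_Ico _ _) continuousOn_cotT fun y hy => ?_
  rw [interior_Ico] at hy
  have hs : 0 < Real.sin y := Real.sin_pos_of_pos_of_lt_pi hy.1 hy.2
  have hd : HasDerivAt (fun y => y * Real.cos y / Real.sin y)
      (((1 * Real.cos y + y * -Real.sin y) * Real.sin y - y * Real.cos y * Real.cos y)
        / Real.sin y ^ 2) y :=
    ((hasDerivAt_id y).mul (Real.hasDerivAt_cos y)).div (Real.hasDerivAt_sin y) hs.ne'
  have he : cotT =ᶠ[nhds y] fun y => y * Real.cos y / Real.sin y := by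
    filter_upwards [eventually_ne_nhds hy.1.ne'] with t ht
    rw [cotT, if_neg ht, Real.cot_eq_cos_div_sin, mul_div_assoc]
  rw [he.deriv_eq, hd.deriv]
  refine div_neg_of_neg_of_pos ?_ (by positivity)
  -- The numerator is `sin y cos y - y = (sin (2y) - 2y) / 2`.
  have h2 := Real.sin_lt (show 0 < 2 * y by linarith [hy.1])
  rw [Real.sin_two_mul] at h2
  have h3 : (1 * Real.cos y + y * -Real.sin y) * Real.sin y - y * Real.cos y * Real.cos y
      = Real.sin y * Real.cos y - y := by
    linear_combination -y * Real.sin_sq_add_cos_sq y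
  linarith

theorem exists_cotT_le (s : ℝ) : ∃ y ∈ Ico 0 Real.pi, cotT y ≤ s := by
  have hsinc : Filter.Tendsto Real.sinc (nhdsWithin Real.pi (Iio Real.pi))
      (nhdsWithin 0 (Ioi 0)) := by
    refine tendsto_nhdsWithin_iff.2 ⟨?_, ?_⟩
    · have h := Real.continuous_sinc.tendsto Real.pi
      rw [Real.sinc_of_ne_zero Real.pi_ne_zero, Real.sin_pi, zero_div] at h
      exact h.mono_left nhdsWithin_le_nhds
    · filter_upwards [Ico_mem_nhdsLT Real.pi_pos] with y hy using sinc_pos_of_mem_Ico hy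
  have hcos : Filter.Tendsto Real.cos (nhdsWithin Real.pi (Iio Real.pi)) (nhds (-1)) := by
    have h := Real.continuous_cos.tendsto Real.pi
    rw [Real.cos_pi] at h
    exact h.mono_left nhdsWithin_le_nhds
  have hT := hcos.neg_mul_atTop (by norm_num) hsinc.inv_tendsto_nhdsGT_zero
  obtain ⟨y, h, hy⟩ := ((hT.eventually (Filter.eventually_le_atBot s)).and
    (Ico_mem_nhdsLT Real.pi_pos)).exists
  refine ⟨y, hy, ?_⟩
  rwa [cotT_eq_cos_div_sinc, div_eq_mul_inv]

theorem bijOn_cotT : BijOn cotT (Ico 0 Real.pi) (Iic 1) := by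
  have h0 : (0 : ℝ) ∈ Ico 0 Real.pi := ⟨le_rfl, Real.pi_pos⟩
  refine ⟨fun y hy => ?_, strictAntiOn_cotT.injOn, fun s hs => ?_⟩
  · rw [mem_Iic, ← cotT_zero]
    exact strictAntiOn_cotT.antitoneOn h0 hy hy.1
  · obtain ⟨y, hy, hys⟩ := exists_cotT_le s
    have hsub : Icc 0 y ⊆ Ico 0 Real.pi := fun t ht => ⟨ht.1, ht.2.trans_lt hy.2⟩
    obtain ⟨t, ht, hts⟩ := intermediate_value_Icc' hy.1 (continuousOn_cotT.mono hsub)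
      ⟨hys, by rw [cotT_zero]; exact hs⟩
    exact ⟨t, hsub ht, hts⟩

theorem cotTInv_mem {s : ℝ} (hs : s ≤ 1) : cotTInv s ∈ Ico 0 Real.pi :=
  Function.invFunOn_mem (bijOn_cotT.surjOn hs)

theorem cotT_cotTInv {s : ℝ} (hs : s ≤ 1) : cotT (cotTInv s) = s :=
  Function.invFunOn_eq (bijOn_cotT.surjOn hs)

/-! ### The rescaled equation `z + a = c e^{-z}` -/

theorem allRootsNeg_iff {δ B k r : ℝ} (hr : 0 < r) :
    AllRootsNeg δ B k r ↔ ∀ z : ℂ,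
      z + (((δ + B) * r : ℝ) : ℂ) = ((k * B * r : ℝ) : ℂ) * Complex.exp (-z) → z.re < 0 := by
  have hr' : (r : ℂ) ≠ 0 := by exact_mod_cast hr.ne'
  have key : ∀ lam : ℂ, IsCharRoot δ B k r lam ↔
      lam * r + (((δ + B) * r : ℝ) : ℂ)
        = ((k * B * r : ℝ) : ℂ) * Complex.exp (-(lam * r)) := by
    intro lam
    rw [IsCharRoot, ← mul_left_inj' hr', neg_mul]
    push_cast
    ring_nf
  constructor
  · intro h z hz
    have h1 := h (z / r) ((key _).2 (by rwa [div_mul_cancel₀ _ hr']))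
    rw [Complex.div_ofReal_re] at h1
    exact (div_neg_iff.1 h1).elim (fun h => absurd h.2 hr.not_gt) (fun h => h.1)
  · intro h lam hlam
    have h1 := h _ ((key lam).1 hlam)
    rw [Complex.re_mul_ofReal] at h1
    exact neg_of_mul_neg_left h1 hr.le

theorem root_iff (a c : ℝ) (z : ℂ) :
    z + (a : ℂ) = (c : ℂ) * Complex.exp (-z) ↔
      z.re + a = c * Real.exp (-z.re) * Real.cos z.im ∧
        z.im = -(c * Real.exp (-z.re) * Real.sin z.im) := by
  rw [Complex.ext_iff]
  simp [Complex.exp_re, Complex.exp_im, mul_assoc]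

/-- A real root exists to the right of any point `x₀` with `x₀ + a ≤ c e^{-x₀}`, because
`x + a - c e^{-x}` tends to `+∞`. -/
theorem exists_real_root {a c x₀ : ℝ} (h : x₀ + a ≤ c * Real.exp (-x₀)) (hx₀ : 0 ≤ x₀) :
    ∃ z : ℂ, z + (a : ℂ) = (c : ℂ) * Complex.exp (-z) ∧ 0 ≤ z.re := by
  have hcont : ContinuousOn (fun x : ℝ => x + a - c * Real.exp (-x))
      (Icc x₀ (x₀ + (|a| + |c|))) := by fun_prop
  have hle : x₀ ≤ x₀ + (|a| + |c|) := by linarith [abs_nonneg a, abs_nonneg c]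
  obtain ⟨x, hx, hx0⟩ := intermediate_value_Icc hle hcont (show (0 : ℝ) ∈ _ by
    refine ⟨by linarith, ?_⟩
    have h1 : Real.exp (-(x₀ + (|a| + |c|))) ≤ 1 := Real.exp_le_one_iff.2 (by linarith)
    have h2 := Real.exp_pos (-(x₀ + (|a| + |c|)))
    have h3 : c * Real.exp (-(x₀ + (|a| + |c|))) ≤ |c| := by
      nlinarith [le_abs_self c, abs_nonneg c]
    linarith [neg_abs_le a])
  refine ⟨(x : ℂ), (root_iff _ _ _).2 ⟨?_, by simp⟩, by simpa using hx₀.trans hx.1⟩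
  simp only [Complex.ofReal_re, Complex.ofReal_im, Real.cos_zero, mul_one]
  linarith

/-- On the closed right half plane the right-hand side has modulus at most `|c|`, while
`|z + a| ≥ a`. -/
theorem re_neg_of_abs_lt {a c : ℝ} (h : |c| < a) {z : ℂ}
    (hz : z + (a : ℂ) = (c : ℂ) * Complex.exp (-z)) : z.re < 0 := by
  by_contra! hx
  have h1 : ‖z + (a : ℂ)‖ ≤ |c| := by
    rw [hz, norm_mul, Complex.norm_exp, Complex.norm_real, Real.norm_eq_abs]
    refine mul_le_of_le_one_right (abs_nonneg c) (Real.exp_le_one_iff.2 ?_)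
    simpa using hx
  have h2 := Complex.re_le_norm (z + (a : ℂ))
  simp only [Complex.add_re, Complex.ofReal_re] at h2
  linarith

/-! ### Unstable roots for a negative coefficient -/

/-- A solution of `e^{-T(y)} = b e^a sinc y` produces a root on the line `Im z = y`. -/
theorem root_of_exp_cotT {a b y : ℝ} (hy : y ∈ Ico 0 Real.pi)
    (h : Real.exp (-cotT y) = b * Real.exp a * Real.sinc y) :
    (⟨-a - cotT y, y⟩ : ℂ) + (a : ℂ)
      = ((-b : ℝ) : ℂ) * Complex.exp (-(⟨-a - cotT y, y⟩ : ℂ)) := by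
  have h1 : b * Real.exp (-(-a - cotT y)) * Real.sinc y = 1 := by
    rw [show -(-a - cotT y) = a + cotT y by ring, Real.exp_add]
    calc b * (Real.exp a * Real.exp (cotT y)) * Real.sinc y
        = b * Real.exp a * Real.sinc y * Real.exp (cotT y) := by ring
      _ = 1 := by rw [← h, ← Real.exp_add, neg_add_cancel, Real.exp_zero]
  refine (root_iff _ _ _).2 ⟨?_, ?_⟩
  · change -a - cotT y + a = -b * Real.exp (-(-a - cotT y)) * Real.cos y
    rw [← cotT_mul_sinc hy]
    linear_combination cotT y * h1
  · change y = -(-b * Real.exp (-(-a - cotT y)) * Real.sin y)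
    rw [← mul_sinc y]
    linear_combination -y * h1

/-- The function `e^{-T} / sinc` takes on `[y₀, π)` every value above the one at `y₀`. -/
theorem exists_exp_cotT_eq {y₀ d : ℝ} (hy₀ : y₀ ∈ Ico 0 Real.pi)
    (h : Real.exp (-cotT y₀) ≤ d * Real.sinc y₀) :
    ∃ y ∈ Ico 0 Real.pi, y₀ ≤ y ∧ Real.exp (-cotT y) = d * Real.sinc y := by
  have hd : 0 < d := pos_of_mul_pos_left ((Real.exp_pos _).trans_le h)
    (sinc_pos_of_mem_Ico hy₀).le
  obtain ⟨y₁, hy₁, h₁⟩ := exists_cotT_le (min (cotT y₀) (-Real.log d))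
  have h01 : y₀ ≤ y₁ :=
    (strictAntiOn_cotT.le_iff_ge hy₁ hy₀).1 (h₁.trans (min_le_left _ _))
  have hsub : Icc y₀ y₁ ⊆ Ico 0 Real.pi :=
    fun t ht => ⟨hy₀.1.trans ht.1, ht.2.trans_lt hy₁.2⟩
  have hcont : ContinuousOn (fun y => Real.exp (-cotT y) - d * Real.sinc y) (Icc y₀ y₁) :=
    ((continuousOn_cotT.mono hsub).neg.rexp).sub
      (continuousOn_const.mul Real.continuous_sinc.continuousOn)
  have hend : d * Real.sinc y₁ ≤ Real.exp (-cotT y₁) :=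
    calc d * Real.sinc y₁ ≤ d := mul_le_of_le_one_right hd.le (Real.sinc_le_one y₁)
      _ = Real.exp (Real.log d) := (Real.exp_log hd).symm
      _ ≤ Real.exp (-cotT y₁) :=
        Real.exp_le_exp.2 (by linarith [h₁.trans (min_le_right _ _)])
  obtain ⟨y, hy, hy0⟩ := intermediate_value_Icc h01 hcont
    (show (0 : ℝ) ∈ _ from ⟨sub_nonpos.2 h, sub_nonneg.2 hend⟩)
  exact ⟨y, hsub hy, hy.1, sub_eq_zero.1 hy0⟩

theorem exists_root_of_one_le_mul_sinc {a b ζ : ℝ} (hζ : ζ ∈ Ico 0 Real.pi)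
    (hT : cotT ζ = -a) (h : 1 ≤ b * Real.sinc ζ) :
    ∃ z : ℂ, z + (a : ℂ) = ((-b : ℝ) : ℂ) * Complex.exp (-z) ∧ 0 ≤ z.re := by
  obtain ⟨y, hy, hζy, he⟩ := exists_exp_cotT_eq (d := b * Real.exp a) hζ (by
    rw [hT, neg_neg]
    nlinarith [Real.exp_pos a])
  refine ⟨_, root_of_exp_cotT hy he, ?_⟩
  have := strictAntiOn_cotT.antitoneOn hζ hy hζy
  change 0 ≤ -a - cotT y
  linarith

/-- For `a ≤ -1` there is always an unstable root. It is real if `b e^{a+1} ≤ 1`, since then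
`x + a + b e^{-x}` is nonpositive at `x = -a - 1`; otherwise it is a root in the strip
`0 ≤ Im z < π`. -/
theorem exists_root_of_le_neg_one {a b : ℝ} (ha : a ≤ -1) :
    ∃ z : ℂ, z + (a : ℂ) = ((-b : ℝ) : ℂ) * Complex.exp (-z) ∧ 0 ≤ z.re := by
  rcases le_total (b * Real.exp (a + 1)) 1 with h | h
  · refine exists_real_root (x₀ := -a - 1) ?_ (by linarith)
    rw [show -(-a - 1) = a + 1 by ring]
    linarith
  · obtain ⟨y, hy, -, he⟩ := exists_exp_cotT_eq (y₀ := 0) (d := b * Real.exp a)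
      ⟨le_rfl, Real.pi_pos⟩ (by
        rw [cotT_zero, Real.sinc_zero, mul_one]
        rw [Real.exp_add, ← mul_assoc] at h
        have h2 : Real.exp (-1) * Real.exp 1 = 1 := by simp [← Real.exp_add]
        nlinarith [Real.exp_pos 1])
    refine ⟨_, root_of_exp_cotT hy he, ?_⟩
    have := bijOn_cotT.mapsTo hy
    rw [mem_Iic] at this
    change 0 ≤ -a - cotT y
    linarith

/-! ### Stability for a negative coefficient -/

/-- The equation `z + a = -b e^{-z}`, split into real and imaginary parts, has no solution
`x + i y` with `x, y ≥ 0`; as roots come in conjugate pairs, this is the heart of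
`re_neg_of_root`. -/
theorem no_root_of_nonneg {a b ζ x y : ℝ} (hζ : ζ ∈ Ico 0 Real.pi) (hT : cotT ζ = -a)
    (ha : -1 < a) (hb : 0 < b) (hab : 0 < a + b) (h : b * Real.sinc ζ < 1)
    (hx : 0 ≤ x) (hy : 0 ≤ y)
    (hre : x + a = -b * Real.exp (-x) * Real.cos y)
    (him : y = -(-b * Real.exp (-x) * Real.sin y)) : False := by
  have he0 := Real.exp_pos (-x)
  have he1 : Real.exp (-x) ≤ 1 := Real.exp_le_one_iff.2 (by linarith)
  have hm0 : 0 < b * Real.exp (-x) := by positivity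
  have hmb : b * Real.exp (-x) ≤ b := mul_le_of_le_one_right hb.le he1
  rcases hy.eq_or_lt with rfl | hy
  · rw [Real.cos_zero] at hre
    rcases le_or_gt 0 a with ha0 | ha0
    · linarith
    · -- Here `x + a + b e^{-x} > x + a (1 - e^{-x}) ≥ (1 + a) x ≥ 0`.
      have h1 := Real.add_one_le_exp (-x)
      nlinarith
  have hs := sinc_pos_of_mem_Ico hζ
  rcases lt_or_ge y Real.pi with hyp | hyp
  · -- Inside the strip, `b e^{-x} sinc y = 1` and `y` lies to the right of `ζ`.
    have hyI : y ∈ Ico 0 Real.pi := ⟨hy.le, hyp⟩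
    have h1 : b * Real.exp (-x) * Real.sinc y = 1 := by
      rw [← mul_sinc] at him
      have : y * (b * Real.exp (-x) * Real.sinc y) = y * 1 := by linarith
      exact mul_left_cancel₀ hy.ne' this
    have hζy : ζ ≤ y := by
      refine (strictAntiOn_cotT.le_iff_ge hyI hζ).1 ?_
      rw [← cotT_mul_sinc hyI] at hre
      have : x + a = -cotT y := by linear_combination hre - cotT y * h1
      linarith
    have h2 : Real.sinc y ≤ Real.sinc ζ :=
      antitoneOn_sinc (Ico_subset_Icc_self hζ) (Ico_subset_Icc_self hyI) hζy
    have h3 : b * Real.exp (-x) * Real.sinc y ≤ b * Real.sinc ζ :=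
      mul_le_mul hmb h2 (sinc_pos_of_mem_Ico hyI).le hb.le
    linarith
  rcases le_or_gt 0 a with ha0 | ha0
  · -- Comparing moduli: `a² + ζ² ≤ |z + a|² ≤ b² < (sinc ζ)⁻² = a² + ζ²`.
    have hy2 : y ^ 2 = (b * Real.exp (-x) * Real.sin y) ^ 2 := by
      congr 1
      linarith
    have hmod : (x + a) ^ 2 + y ^ 2 = (b * Real.exp (-x)) ^ 2 := by
      rw [hre, hy2]
      linear_combination (b * Real.exp (-x)) ^ 2 * Real.sin_sq_add_cos_sq y
    have hζ2 : (a ^ 2 + ζ ^ 2) * Real.sinc ζ ^ 2 = 1 := by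
      have h1 := cotT_mul_sinc hζ
      rw [hT] at h1
      have h2 := Real.sin_sq_add_cos_sq ζ
      rw [← h1, ← mul_sinc ζ] at h2
      linarith
    have h3 : a ^ 2 + ζ ^ 2 ≤ b ^ 2 := by
      have := pow_le_pow_left₀ hm0.le hmb 2
      have := pow_le_pow_left₀ hζ.1 (hζ.2.le.trans hyp) 2
      nlinarith
    have h4 : (b * Real.sinc ζ) ^ 2 < 1 := pow_lt_one₀ (by positivity) h two_ne_zero
    have h5 := mul_le_mul_of_nonneg_right h3 (sq_nonneg (Real.sinc ζ))
    rw [mul_pow] at h4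
    linarith
  · -- For `a < 0`, `T ζ > 0` puts `ζ` in `[0, π / 2)`, where `sinc ≥ 2 / π`.
    have hc : 0 < Real.cos ζ := by
      rw [← cotT_mul_sinc hζ, hT]
      exact mul_pos (by linarith) hs
    have hζ2 : ζ ≤ Real.pi / 2 := by
      by_contra! h2
      linarith [Real.cos_nonpos_of_pi_div_two_le_of_le h2.le (by linarith [hζ.2])]
    have hyb : y ≤ b := by
      have := Real.sin_le_one y
      nlinarith
    have hj := antitoneOn_sinc (Ico_subset_Icc_self hζ)
      ⟨by positivity, by linarith [Real.pi_pos]⟩ hζ2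
    rw [Real.sinc_of_ne_zero (by positivity), Real.sin_pi_div_two] at hj
    have h3 : b * (1 / (Real.pi / 2)) < 1 := (mul_le_mul_of_nonneg_left hj hb.le).trans_lt h
    rw [mul_one_div, div_lt_one (by positivity)] at h3
    linarith [Real.pi_pos]

theorem re_neg_of_root {a b ζ : ℝ} (hζ : ζ ∈ Ico 0 Real.pi) (hT : cotT ζ = -a)
    (ha : -1 < a) (hb : 0 < b) (hab : 0 < a + b) (h : b * Real.sinc ζ < 1) {z : ℂ}
    (hz : z + (a : ℂ) = ((-b : ℝ) : ℂ) * Complex.exp (-z)) : z.re < 0 := by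
  obtain ⟨hre, him⟩ := (root_iff _ _ _).1 hz
  by_contra! hx
  rcases le_total 0 z.im with hy | hy
  · exact no_root_of_nonneg hζ hT ha hb hab h hx hy hre him
  · refine no_root_of_nonneg (y := -z.im) hζ hT ha hb hab h hx (by linarith) ?_ ?_
    · rwa [Real.cos_neg]
    · rw [Real.sin_neg]
      linarith

/-! ### Stability criteria in rescaled form -/

/-- Since `sinc ζ = sin ζ / ζ`, the last condition is Hayes's criterion `b < ζ / sin ζ`, in a form
that remains meaningful at `ζ = 0`. -/
theorem neg_coeff_stable_iff {a b : ℝ} (hb : 0 < b) :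
    (∀ z : ℂ, z + (a : ℂ) = ((-b : ℝ) : ℂ) * Complex.exp (-z) → z.re < 0) ↔
      -1 < a ∧ -a < b ∧ b * Real.sinc (cotTInv (-a)) < 1 := by
  constructor
  · intro h
    have h1 : -1 < a := by
      by_contra! ha1
      obtain ⟨z, hz, hre⟩ := exists_root_of_le_neg_one (b := b) ha1
      exact hre.not_gt (h z hz)
    have ha1 : -a ≤ 1 := by linarith
    refine ⟨h1, ?_, ?_⟩
    · by_contra! hab
      obtain ⟨z, hz, hre⟩ := exists_real_root (a := a) (c := -b) (x₀ := 0)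
        (by rw [neg_zero, Real.exp_zero]; linarith) le_rfl
      exact hre.not_gt (h z hz)
    · by_contra! hs
      obtain ⟨z, hz, hre⟩ :=
        exists_root_of_one_le_mul_sinc (cotTInv_mem ha1) (cotT_cotTInv ha1) hs
      exact hre.not_gt (h z hz)
  · rintro ⟨h1, hab, hs⟩ z hz
    have ha1 : -a ≤ 1 := by linarith
    exact re_neg_of_root (cotTInv_mem ha1) (cotT_cotTInv ha1) h1 hb (by linarith) hs hz

/-- For `a > 0` the first two conditions of `neg_coeff_stable_iff` hold automatically; the case
`b < a` is split off because `-a / b` is then outside the range of the cosine. -/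
theorem neg_coeff_stable_iff_of_pos {a b : ℝ} (ha : 0 < a) (hb : 0 < b) :
    (∀ z : ℂ, z + (a : ℂ) = ((-b : ℝ) : ℂ) * Complex.exp (-z) → z.re < 0) ↔
      b < a ∨ a ≤ b ∧ b * Real.sinc (cotTInv (-a)) < 1 := by
  have ha1 : -a ≤ 1 := by linarith
  constructor
  · intro h
    refine (lt_or_ge b a).imp_right fun hab => ⟨hab, ?_⟩
    by_contra! hs
    obtain ⟨z, hz, hre⟩ :=
      exists_root_of_one_le_mul_sinc (cotTInv_mem ha1) (cotT_cotTInv ha1) hs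
    exact hre.not_gt (h z hz)
  · rintro (hab | ⟨-, hs⟩) z hz
    · exact re_neg_of_abs_lt (by rwa [abs_neg, abs_of_pos hb]) hz
    · exact re_neg_of_root (cotTInv_mem ha1) (cotT_cotTInv ha1) (by linarith) hb
        (by linarith) hs hz

theorem pos_coeff_stable_iff {a c : ℝ} (hc : 0 < c) :
    (∀ z : ℂ, z + (a : ℂ) = (c : ℂ) * Complex.exp (-z) → z.re < 0) ↔ c < a := by
  constructor
  · intro h
    by_contra! hac
    obtain ⟨z, hz, hre⟩ := exists_real_root (a := a) (c := c) (x₀ := 0)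
      (by rw [neg_zero, Real.exp_zero]; linarith) le_rfl
    exact hre.not_gt (h z hz)
  · intro h z hz
    exact re_neg_of_abs_lt (by rwa [abs_of_pos hc]) hz

/-! ### Reformulation with the arccosine -/

theorem arccos_lt_iff {u ζ : ℝ} (hu : u ∈ Icc (-1) 1) (hζ : ζ ∈ Icc 0 Real.pi) :
    Real.arccos u < ζ ↔ Real.cos ζ < u := by
  conv_lhs => rw [← Real.arccos_cos hζ.1 hζ.2]
  exact Real.strictAntiOn_arccos.lt_iff_gt hu ⟨Real.neg_one_le_cos ζ, Real.cos_le_one ζ⟩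

theorem lt_arccos_iff {u ζ : ℝ} (hu : u ∈ Icc (-1) 1) (hζ : ζ ∈ Icc 0 Real.pi) :
    ζ < Real.arccos u ↔ u < Real.cos ζ := by
  conv_lhs => rw [← Real.arccos_cos hζ.1 hζ.2]
  exact Real.strictAntiOn_arccos.lt_iff_gt ⟨Real.neg_one_le_cos ζ, Real.cos_le_one ζ⟩ hu

theorem cotTInv_pos {s : ℝ} (hs : s < 1) : 0 < cotTInv s := by
  refine (cotTInv_mem hs.le).1.lt_of_ne fun h => ?_
  have := cotT_cotTInv hs.le
  rw [← h, cotT_zero] at this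
  exact hs.ne' this

theorem cos_cotTInv {s : ℝ} (hs : s ≤ 1) :
    Real.cos (cotTInv s) = s * Real.sinc (cotTInv s) := by
  conv_rhs => rw [← cotT_cotTInv hs]
  rw [cotT_cotTInv hs, ← cotT_mul_sinc (cotTInv_mem hs), cotT_cotTInv hs]

theorem arccos_lt_cotTInv_iff {a b : ℝ} (ha : a < 0) (ha1 : -1 < a) (hab : -a < b) :
    Real.arccos (-a / b) < cotTInv (-a) ↔ b * Real.sinc (cotTInv (-a)) < 1 := by
  have hb : 0 < b := by linarith
  have h1 : -a ≤ 1 := by linarith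
  rw [arccos_lt_iff ⟨by linarith [div_nonneg (neg_nonneg.2 ha.le) hb.le],
    (div_le_one hb).2 hab.le⟩ (Ico_subset_Icc_self (cotTInv_mem h1)), cos_cotTInv h1,
    lt_div_iff₀ hb, mul_assoc, mul_lt_iff_lt_one_right (neg_pos.2 ha), mul_comm b]

theorem cotTInv_lt_arccos_iff {a b : ℝ} (ha : 0 < a) (hab : a ≤ b) :
    cotTInv (-a) < Real.arccos (-a / b) ↔ b * Real.sinc (cotTInv (-a)) < 1 := by
  have hb : 0 < b := by linarith
  have h1 : -a ≤ 1 := by linarith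
  have h2 : a / b ≤ 1 := (div_le_one hb).2 hab
  rw [lt_arccos_iff ⟨by rw [neg_div]; linarith, by rw [neg_div]; linarith [div_pos ha hb]⟩
    (Ico_subset_Icc_self (cotTInv_mem h1)), cos_cotTInv h1, div_lt_iff₀ hb, mul_assoc, neg_mul,
    neg_lt_neg_iff, mul_lt_iff_lt_one_right ha, mul_comm b]

theorem div_omegaZero_lt_iff {δ B r θ : ℝ} (hr : 0 < r) (h : -(δ + B) * r < 1) :
    θ / omegaZero δ B r < r ↔ θ < cotTInv (-((δ + B) * r)) := by
  have := cotTInv_pos h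
  rw [omegaZero, div_lt_iff₀ (by positivity), ← mul_assoc, mul_one_div_cancel hr.ne', one_mul,
    neg_mul]

theorem lt_div_omegaZero_iff {δ B r θ : ℝ} (hr : 0 < r) (h : -(δ + B) * r < 1) :
    r < θ / omegaZero δ B r ↔ cotTInv (-((δ + B) * r)) < θ := by
  have := cotTInv_pos h
  rw [omegaZero, lt_div_iff₀ (by positivity), ← mul_assoc, mul_one_div_cancel hr.ne', one_mul,
    neg_mul]

theorem mainTheorem2 :
    -- the function `T` is a bijection from `[0, π)` onto `(-∞, 1]`
    Set.BijOn cotT (Set.Ico 0 Real.pi) (Set.Iic 1) ∧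
    ∀ δ B k r : ℝ, 0 < δ → 0 < k → 0 < r →
      -- case I.A
      (B < 0 → δ + B < 0 →
        (AllRootsNeg δ B k r ↔
          |δ + B| < |k * B| ∧
            Real.arccos ((δ + B) / (k * B)) / omegaZero δ B r < r ∧ r < 1 / |δ + B|)) ∧
      -- case I.B
      (B < 0 → 0 < δ + B →
        (AllRootsNeg δ B k r ↔
          |k * B| < δ + B ∨
            (δ + B ≤ |k * B| ∧
              r < Real.arccos ((δ + B) / (k * B)) / omegaZero δ B r))) ∧
      -- case II
      (0 < B →
        0 < δ + B ∧ (AllRootsNeg δ B k r ↔ k * B < δ + B)) := by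
  refine ⟨bijOn_cotT, fun δ B k r hδ hk hr => ⟨fun hB hs => ?_, fun hB hs => ?_, fun hB => ?_⟩⟩
  · have hkB : k * B < 0 := mul_neg_of_pos_of_neg hk hB
    have hb : 0 < -(k * B * r) := neg_pos.2 (mul_neg_of_neg_of_pos hkB hr)
    have ha : (δ + B) * r < 0 := mul_neg_of_neg_of_pos hs hr
    have hu : (δ + B) / (k * B) = -((δ + B) * r) / -(k * B * r) := by
      rw [neg_div_neg_eq, mul_div_mul_right _ _ hr.ne']
    have hr1 : r < 1 / |δ + B| ↔ -1 < (δ + B) * r := by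
      rw [abs_of_neg hs, lt_div_iff₀ (by linarith)]
      constructor <;> intro h <;> linarith
    have hab : |δ + B| < |k * B| ↔ -((δ + B) * r) < -(k * B * r) := by
      rw [abs_of_neg hs, abs_of_neg hkB, ← neg_mul (δ + B), ← neg_mul (k * B),
        mul_lt_mul_iff_left₀ hr]
    have key := neg_coeff_stable_iff hb (a := (δ + B) * r)
    rw [neg_neg] at key
    rw [allRootsNeg_iff hr, key, hab, hr1, hu]
    constructor
    · rintro ⟨h1, h2, h3⟩
      exact ⟨h2, (div_omegaZero_lt_iff hr (by linarith)).2 ((arccos_lt_cotTInv_iff ha h1 h2).2 h3),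
        h1⟩
    · rintro ⟨h2, h3, h1⟩
      exact ⟨h1, h2, (arccos_lt_cotTInv_iff ha h1 h2).1
        ((div_omegaZero_lt_iff hr (by linarith)).1 h3)⟩
  · have hkB : k * B < 0 := mul_neg_of_pos_of_neg hk hB
    have hb : 0 < -(k * B * r) := neg_pos.2 (mul_neg_of_neg_of_pos hkB hr)
    have ha : 0 < (δ + B) * r := mul_pos hs hr
    have hu : (δ + B) / (k * B) = -((δ + B) * r) / -(k * B * r) := by
      rw [neg_div_neg_eq, mul_div_mul_right _ _ hr.ne']
    have hlt : |k * B| < δ + B ↔ -(k * B * r) < (δ + B) * r := by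
      rw [abs_of_neg hkB, ← neg_mul (k * B), mul_lt_mul_iff_left₀ hr]
    have hle : δ + B ≤ |k * B| ↔ (δ + B) * r ≤ -(k * B * r) := by
      rw [abs_of_neg hkB, ← neg_mul (k * B), mul_le_mul_iff_left₀ hr]
    have key := neg_coeff_stable_iff_of_pos ha hb
    rw [neg_neg] at key
    rw [allRootsNeg_iff hr, key, hlt, hle, hu, lt_div_omegaZero_iff hr (by linarith)]
    exact or_congr_right (and_congr_right fun h => (cotTInv_lt_arccos_iff ha h).symm)
  · refine ⟨by linarith, ?_⟩
    rw [allRootsNeg_iff hr, pos_coeff_stable_iff (by positivity), mul_lt_mul_iff_left₀ hr]
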